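/- Let $0\le k<n$ be integers. There exist Borel sets $B_1,B_2\subset\mathbb{R}^n$, each of Hausdorff dimension exactly $k+1$, such that for every $x\in\mathbb{R}^n$: (i) for every $d>0$ the set $B_1$ contains a $k$-dimensional affine subspace of $\mathbb{R}^n$ whose Euclidean distance from $x$ is $d$; (ii) for every $r>0$ the set $B_2$ contains the $k$-skeleton of an $n$-dimensional (possibly rotated) cube of edge length $r$ centered at $x$, that is, there is a rotation $\rho\in SO(n)$ with $x+\rho(T_{k,r})\subset B_2$, where $T_{k,r}$ is the union of all $k$-dimensional closed faces of the cube $[-r/2,r/2]^n$. -/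

import Mathlib

/-- The closed face of the axis-parallel cube `[-r/2, r/2]ⁿ` (edge length `r`, centred at the
origin) on which the coordinates in `J` are free and each coordinate `i` outside `J` is fixed at
the value `r/2` (when `σ i = true`) or `-r/2` (when `σ i = false`). Its dimension is `J.card`. -/
def cubeFace (n : ℕ) (r : ℝ) (J : Finset (Fin n)) (σ : Fin n → Bool) :
    Set (EuclideanSpace ℝ (Fin n)) :=
  {y | (∀ i ∈ J, -(r / 2) ≤ y i ∧ y i ≤ r / 2) ∧
    ∀ i, i ∉ J → y i = if σ i then r / 2 else -(r / 2)}

/-- The `k`-skeleton of the cube `[-r/2, r/2]ⁿ`: the union of its `k`-dimensional faces. -/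
def cubeSkeleton (n k : ℕ) (r : ℝ) : Set (EuclideanSpace ℝ (Fin n)) :=
  {y | ∃ (J : Finset (Fin n)) (σ : Fin n → Bool), J.card = k ∧ y ∈ cubeFace n r J σ}

/-- A linear isometry of `ℝⁿ` is a rotation if it preserves orientation, i.e. lies in `SO(n)`. -/
def IsRotation {n : ℕ}
    (ρ : EuclideanSpace ℝ (Fin n) ≃ₗᵢ[ℝ] EuclideanSpace ℝ (Fin n)) : Prop :=
  LinearMap.det (ρ.toLinearEquiv : EuclideanSpace ℝ (Fin n) →ₗ[ℝ] EuclideanSpace ℝ (Fin n)) = 1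

/-- `P` is a `k`-plane: a nonempty affine subspace of `ℝⁿ` of dimension `k`. -/
def IsKPlane {n : ℕ} (k : ℕ) (P : AffineSubspace ℝ (EuclideanSpace ℝ (Fin n))) : Prop :=
  (P : Set (EuclideanSpace ℝ (Fin n))).Nonempty ∧ Module.finrank ℝ P.direction = k

open Set Filter Topology MeasureTheory Metric Module
open scoped ENNReal NNReal RealInnerProductSpace


/-! A single set serves as `B₁` and `B₂`. A `k`-face of a centred cube lies in a plane `p + U` with
`U` a coordinate subspace, `p ⊥ U` and `p ≠ 0` since `k < n`, hence in the `(k+1)`-dimensional space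
`W = U + ℝp`. Take all `q + g W` with `q`, `g` in countable dense sets of points and rotations:
their union has dimension `k + 1`, and so does some Gδ set `B` around it
(`exists_isGδ_superset_dimH_eq`).

For (i), a `q + g W` passing within `d` of `x` contains a `k`-plane at distance exactly `d`
(`exists_plane_infDist_eq`). For (ii), fix `x` and `r`. For each face, the rotations placing it in
`B` form a Gδ set (`isGδ_setOf_rotation_mapsTo`), dense because a small change of rotation moves the
face into some `q + g W` (`dense_setOf_rotation_into_planes`). By Baire, one rotation works for all
the finitely many faces. -/

theorem exists_pos_add_rpow_le {D e : ℝ≥0∞} {d : ℝ} {η : ℝ≥0∞} (hd : 0 < d) (hη : η ≠ 0)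
    (hDe : D < e) (hD : D ≠ ∞) :
    ∃ δ : ℝ≥0, 0 < δ ∧ D + 2 * δ ≤ e ∧ (D + 2 * δ) ^ d ≤ D ^ d + η := by
  have hc : Continuous fun δ : ℝ≥0 => D + 2 * (δ : ℝ≥0∞) :=
    continuous_const.add (ENNReal.continuous_const_mul (by simp) |>.comp ENNReal.continuous_coe)
  have hc' : Continuous fun δ : ℝ≥0 => (D + 2 * (δ : ℝ≥0∞)) ^ d :=
    ENNReal.continuous_rpow_const.comp hc
  have h1 : ∀ᶠ δ : ℝ≥0 in 𝓝 0, D + 2 * (δ : ℝ≥0∞) < e :=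
    hc.continuousAt.eventually_lt_const (by simpa using hDe)
  have h2 : ∀ᶠ δ : ℝ≥0 in 𝓝 0, (D + 2 * (δ : ℝ≥0∞)) ^ d < D ^ d + η :=
    hc'.continuousAt.eventually_lt_const (by
      simpa using ENNReal.lt_add_right (ENNReal.rpow_ne_top_of_nonneg hd.le hD) hη)
  obtain ⟨δ, ⟨ha, hb⟩, hδ⟩ :=
    ((h1.and h2).filter_mono nhdsWithin_le_nhds |>.and
      (self_mem_nhdsWithin : Ioi (0 : ℝ≥0) ∈ 𝓝[>] 0)).exists
  exact ⟨δ, hδ, ha.le, hb.le⟩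

/-! ### Gδ hulls of the same Hausdorff dimension. -/

section Hull
variable {X : Type*} [EMetricSpace X] [MeasurableSpace X] [BorelSpace X]

/-- Thickening each set of a good cover makes it open; the widths are chosen so that the increases
of the `d`-th powers are summable with sum below `e / 2`. -/
theorem exists_isOpen_cover_of_hausdorffMeasure_eq_zero {C : Set X} {d : ℝ} (hd : 0 < d)
    (h : μH[d] C = 0) {e : ℝ≥0∞} (he : 0 < e) (he' : e ≠ ∞) :
    ∃ t : ℕ → Set X, (∀ i, IsOpen (t i)) ∧ C ⊆ ⋃ i, t i ∧ (∀ i, ediam (t i) ≤ e) ∧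
      ∑' i, ediam (t i) ^ d ≤ e := by
  have he2 : 0 < e / 2 := ENNReal.half_pos he.ne'
  rw [Measure.hausdorffMeasure_apply, ENNReal.iSup_eq_zero] at h
  have h' := h (e / 2)
  rw [ENNReal.iSup_eq_zero] at h'
  have h'' := (h' he2).trans_lt he2
  simp only [iInf_lt_iff] at h''
  obtain ⟨t, hCt, htd, hts⟩ := h''
  obtain ⟨η, hη, hηs⟩ := ENNReal.exists_pos_sum_of_countable' he2.ne' ℕ
  have hlt : ∀ i, ediam (t i) < e := fun i => (htd i).trans_lt (ENNReal.half_lt_self he.ne' he')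
  choose δ hδ hδe hδd using fun i => exists_pos_add_rpow_le hd (hη i).ne' (hlt i) (hlt i).ne_top
  refine ⟨fun i => thickening (δ i) (t i), fun i => isOpen_thickening, hCt.trans
    (iUnion_mono fun i => self_subset_thickening (by exact_mod_cast hδ i) _),
    fun i => (ediam_thickening_le _).trans (hδe i), ?_⟩
  have hsup : ∀ i, ⨆ _ : (t i).Nonempty, ediam (t i) ^ d = ediam (t i) ^ d := by
    intro i
    rcases (t i).eq_empty_or_nonempty with h0 | h0
    · simp [h0, hd]
    · simp [h0]
  simp only [hsup] at hts
  calc ∑' i, ediam (thickening (δ i) (t i)) ^ d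
      ≤ ∑' i, (ediam (t i) ^ d + η i) := ENNReal.tsum_le_tsum fun i =>
        (ENNReal.rpow_le_rpow (ediam_thickening_le _) hd.le).trans (hδd i)
    _ = ∑' i, ediam (t i) ^ d + ∑' i, η i := ENNReal.tsum_add
    _ ≤ e / 2 + e / 2 := add_le_add hts.le hηs.le
    _ = e := ENNReal.add_halves e

theorem exists_isGδ_superset_hausdorffMeasure_eq_zero {C : Set X} {d : ℝ} (hd : 0 < d)
    (h : μH[d] C = 0) : ∃ G, IsGδ G ∧ C ⊆ G ∧ μH[d] G = 0 := by
  have he : ∀ n : ℕ, 0 < ((n : ℝ≥0∞) + 1)⁻¹ := fun n => by simp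
  have he' : ∀ n : ℕ, ((n : ℝ≥0∞) + 1)⁻¹ ≠ ∞ := fun n => by simp
  choose t hto hCt htd hts using fun n : ℕ =>
    exists_isOpen_cover_of_hausdorffMeasure_eq_zero hd h (he n) (he' n)
  have hlim : Tendsto (fun n : ℕ => ((n : ℝ≥0∞) + 1)⁻¹) atTop (𝓝 0) := by
    have := (tendsto_add_atTop_iff_nat 1).2 ENNReal.tendsto_inv_nat_nhds_zero
    simpa using this
  refine ⟨⋂ n, ⋃ i, t n i, .iInter_of_isOpen fun n => isOpen_iUnion (hto n),
    subset_iInter hCt, ?_⟩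
  refine le_antisymm ?_ zero_le
  refine (Measure.hausdorffMeasure_le_liminf_tsum d _ _ hlim t
    (.of_forall htd) (.of_forall fun n => iInter_subset _ n)).trans ?_
  exact (liminf_le_liminf (.of_forall hts)).trans hlim.liminf_eq.le

end Hull

theorem exists_isGδ_superset_dimH_eq {X : Type*} [EMetricSpace X] (C : Set X) :
    ∃ G, IsGδ G ∧ C ⊆ G ∧ dimH G = dimH C := by
  borelize X
  have key : ∀ q : ℚ, ∃ G, IsGδ G ∧ C ⊆ G ∧
      (dimH C < (Real.toNNReal q : ℝ≥0∞) → μH[(Real.toNNReal q : ℝ)] G = 0) := by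
    intro q
    by_cases hq : dimH C < (Real.toNNReal q : ℝ≥0∞)
    · obtain ⟨G, h1, h2, h3⟩ := exists_isGδ_superset_hausdorffMeasure_eq_zero
        (by exact_mod_cast zero_le.trans_lt hq) (hausdorffMeasure_of_dimH_lt hq)
      exact ⟨G, h1, h2, fun _ => h3⟩
    -- For `q` not above the dimension nothing is required, so the whole space will do.
    · exact ⟨univ, .univ, subset_univ _, fun h => absurd h hq⟩
  choose G hG hCG hG0 using key
  refine ⟨⋂ q, G q, .iInter hG, subset_iInter hCG, le_antisymm ?_ (dimH_mono (subset_iInter hCG))⟩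
  refine le_of_forall_gt fun c hc => ?_
  obtain ⟨q, -, hq1, hq2⟩ := ENNReal.lt_iff_exists_rat_btwn.1 hc
  refine (dimH_le_of_hausdorffMeasure_ne_top ?_).trans_lt hq2
  rw [measure_mono_null (iInter_subset _ q) (hG0 q hq1)]
  simp

/-! ### The space of rotations and perturbation of planes. -/

section Rotations
variable (E : Type*) [NormedAddCommGroup E] [InnerProductSpace ℝ E]

/-- The rotations of `E`, as a subset of the normed space of continuous linear maps. -/
def rotationSet : Set (E →L[ℝ] E) := {A | (∀ x, ‖A x‖ = ‖x‖) ∧ A.det = 1}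

variable {E}

theorem id_mem_rotationSet : ContinuousLinearMap.id ℝ E ∈ rotationSet E :=
  ⟨fun _ => rfl, LinearMap.det_id⟩

theorem comp_mem_rotationSet {A B : E →L[ℝ] E} (hA : A ∈ rotationSet E) (hB : B ∈ rotationSet E) :
    A.comp B ∈ rotationSet E := by
  refine ⟨fun x => by simp [hA.1, hB.1], ?_⟩
  have := LinearMap.det_comp (A : E →ₗ[ℝ] E) (B : E →ₗ[ℝ] E)
  exact this.trans (by rw [show LinearMap.det (A : E →ₗ[ℝ] E) = 1 from hA.2,
    show LinearMap.det (B : E →ₗ[ℝ] E) = 1 from hB.2, one_mul])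

theorem isClosed_rotationSet : IsClosed (rotationSet E) := by
  have h : rotationSet E = (⋂ x, {A : E →L[ℝ] E | ‖A x‖ = ‖x‖}) ∩ {A | A.det = 1} := by
    ext A; simp [rotationSet]
  rw [h]
  refine (isClosed_iInter fun x => isClosed_eq (by fun_prop) continuous_const).inter ?_
  exact isClosed_eq (ContinuousLinearMap.continuous_det (𝕜 := ℝ) (E := E)) continuous_const

theorem isGδ_setOf_rotation_mapsTo {B K : Set E} (hB : IsGδ B) (hK : IsCompact K) (x : E) :
    IsGδ {A : rotationSet E | ∀ y ∈ K, x + A.1 y ∈ B} := by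
  obtain ⟨U, hU, rfl⟩ := isGδ_iff_eq_iInter_nat.1 hB
  have : {A : rotationSet E | ∀ y ∈ K, x + A.1 y ∈ ⋂ n, U n} =
      ⋂ n, {A : rotationSet E | ∀ y ∈ K, x + A.1 y ∈ U n} := by
    ext A
    simp only [mem_iInter, mem_ofPred_eq]
    exact ⟨fun h n y hy => h y hy n, fun h y hy n => h n y hy⟩
  rw [this]
  refine .iInter_of_isOpen fun n => isOpen_iff_eventually.2 fun A hA => ?_
  -- Compactness of `K` makes the condition open in `A`, as in the tube lemma.
  refine hK.eventually_forall_of_forall_eventually fun y hy => ?_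
  have hc : Continuous fun z : rotationSet E × E => x + z.1.1 z.2 := by fun_prop
  exact hc.continuousAt.eventually ((hU n).mem_nhds (hA y hy))

/-- The reflection in the line spanned by `v`, as a function of `v`. -/
noncomputable def lineReflection (v : E) : E →L[ℝ] E :=
  (2 * (‖v‖ ^ 2)⁻¹) • (innerSL ℝ v).smulRight v - ContinuousLinearMap.id ℝ E

theorem lineReflection_apply (v x : E) : lineReflection v x = (ℝ ∙ v).reflection x := by
  rw [Submodule.reflection_singleton_apply]
  simp only [lineReflection, sub_apply, smul_apply,
    ContinuousLinearMap.smulRight_apply, innerSL_apply_apply, ContinuousLinearMap.id_apply,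
    RCLike.ofReal_real_eq_id, id_eq, two_smul, smul_smul, ← add_smul]
  congr 2
  ring

theorem continuousAt_lineReflection {v : E} (hv : v ≠ 0) :
    ContinuousAt (lineReflection : E → E →L[ℝ] E) v := by
  have h1 : ContinuousAt (fun v : E => 2 * (‖v‖ ^ 2)⁻¹) v :=
    continuousAt_const.mul (ContinuousAt.inv₀ (by fun_prop) (by simpa using hv))
  have h2 : ContinuousAt (fun v : E => (innerSL ℝ v).smulRight v) v :=
    Continuous.continuousAt (by fun_prop)
  exact (h1.smul h2).sub continuousAt_const

theorem lineReflection_self (v : E) : lineReflection v v = v := by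
  rw [lineReflection_apply]
  exact Submodule.reflection_mem_subspace_eq_self (Submodule.mem_span_singleton_self v)

theorem lineReflection_of_inner_eq_zero {v x : E} (h : ⟪v, x⟫ = 0) : lineReflection v x = -x := by
  simp [lineReflection, h]

theorem lineReflection_add {v w : E} (h : ‖v‖ = ‖w‖) : lineReflection (v + w) v = w := by
  have := Submodule.reflection_sub (v := v) (w := -w) (by simpa using h)
  rw [Submodule.reflection_orthogonal_apply, sub_neg_eq_add, neg_inj] at this
  rw [lineReflection_apply, this]

theorem lineReflection_smul {c : ℝ} (hc : c ≠ 0) (v : E) :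
    lineReflection (c • v) = lineReflection v := by
  ext x
  rw [lineReflection_apply, lineReflection_apply]
  congr 2
  exact Submodule.span_singleton_smul_eq hc.isUnit v

theorem lineReflection_comp_self {v : E} :
    (lineReflection v).comp (lineReflection v) = ContinuousLinearMap.id ℝ E := by
  ext x
  simp [lineReflection_apply]

variable [FiniteDimensional ℝ E]

instance : CompleteSpace (rotationSet E) := isClosed_rotationSet.completeSpace_coe

instance : Nonempty (rotationSet E) := ⟨⟨_, id_mem_rotationSet⟩⟩

theorem exists_linearIsometryEquiv_of_mem_rotationSet {A : E →L[ℝ] E} (hA : A ∈ rotationSet E) :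
    ∃ ρ : E ≃ₗᵢ[ℝ] E, (∀ x, ρ x = A x) ∧ LinearMap.det (ρ.toLinearEquiv : E →ₗ[ℝ] E) = 1 := by
  let ρ := LinearIsometry.toLinearIsometryEquiv (⟨(A : E →ₗ[ℝ] E), hA.1⟩ : E →ₗᵢ[ℝ] E) rfl
  have hρ : ∀ x, ρ x = A x := fun x => rfl
  refine ⟨ρ, hρ, ?_⟩
  have : (ρ.toLinearEquiv : E →ₗ[ℝ] E) = (A : E →ₗ[ℝ] E) := by ext x; exact hρ x
  rw [this]; exact hA.2

theorem det_lineReflection {v : E} (hv : v ≠ 0) :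
    (lineReflection v).det = (-1) ^ (finrank ℝ E - 1) := by
  have h : ((lineReflection v : E →L[ℝ] E) : E →ₗ[ℝ] E) = (ℝ ∙ v).reflection.toLinearMap := by
    ext x; exact lineReflection_apply v x
  have hf := (ℝ ∙ v).finrank_add_finrank_orthogonal
  rw [finrank_span_singleton hv] at hf
  rw [ContinuousLinearMap.det, h]
  refine ((ℝ ∙ v).det_reflection).trans ?_
  congr 1; omega

theorem lineReflection_comp_mem_rotationSet {v w : E} (hv : v ≠ 0) (hw : w ≠ 0) :
    (lineReflection v).comp (lineReflection w) ∈ rotationSet E := by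
  refine ⟨fun x => by simp [lineReflection_apply], ?_⟩
  refine (LinearMap.det_comp (lineReflection v : E →ₗ[ℝ] E) (lineReflection w : E →ₗ[ℝ] E)).trans ?_
  have h1 := det_lineReflection hv
  have h2 := det_lineReflection hw
  rw [ContinuousLinearMap.det] at h1 h2
  rw [h1, h2, ← mul_pow]
  simp

/-- An affine plane `p + U` avoiding the origin can be rotated, by a rotation depending
continuously on `z` near `0`, into the translate `-z + W` of a subspace `W` containing it. -/
theorem exists_continuousAt_rotation_into_translate {U W : Submodule ℝ E} {p : E} (hp : p ≠ 0)
    (hpU : ∀ u ∈ U, ⟪p, u⟫ = 0) (hUW : U ≤ W) (hpW : p ∈ W) :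
    ∃ s : E → E →L[ℝ] E, ContinuousAt s 0 ∧ s 0 = ContinuousLinearMap.id ℝ E ∧
      ∀ᶠ z in 𝓝 0, s z ∈ rotationSet E ∧ ∀ u ∈ U, z + s z (p + u) ∈ W := by
  -- `z'` is the part of `z` orthogonal to `W`, and `c` makes `‖u' z‖ = ‖p‖`, so that `z + u' z ∈
  -- W`.
  let z' : E → E := fun z => z - W.starProjection z
  let c : E → ℝ := fun z => √(1 - ‖z' z‖ ^ 2 / ‖p‖ ^ 2)
  let u' : E → E := fun z => c z • p - z' z
  have hz'c : Continuous z' := by fun_prop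
  have hcc : Continuous c := by fun_prop
  have hu'c : Continuous u' := by fun_prop
  have hz0 : z' 0 = 0 := by simp [z']
  have hc0 : c 0 = 1 := by simp [c, hz0]
  have hu0 : u' 0 = p := by simp [u', hz0, hc0]
  have hpp : p + p ≠ 0 := by
    rw [← two_smul ℝ p]; exact smul_ne_zero two_ne_zero hp
  have hz'W : ∀ z, ∀ w ∈ W, ⟪z' z, w⟫ = 0 := fun z w hw =>
    Submodule.starProjection_inner_eq_zero z w hw
  have hpn : 0 < ‖p‖ := norm_pos_iff.2 hp
  -- The first reflection fixes `p` and negates `U`; the second sends `p` to `u' z` and negates `U`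
  -- again. The product thus fixes `U` pointwise.
  refine ⟨fun z => (lineReflection (p + u' z)).comp (lineReflection p), ?_, ?_, ?_⟩
  · refine ContinuousAt.clm_comp ?_ continuousAt_const
    have h := continuousAt_lineReflection hpp
    nth_rewrite 2 [← hu0] at h
    exact h.comp (f := fun z => p + u' z) (continuous_const.add hu'c).continuousAt
  · simp only [hu0, ← two_smul ℝ p, lineReflection_smul two_ne_zero, lineReflection_comp_self]
  · have h1 : ∀ᶠ z in 𝓝 0, p + u' z ≠ 0 :=
      (continuous_const.add hu'c).continuousAt.eventually_ne (by simpa [hu0] using hpp)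
    have h2 : ∀ᶠ z in 𝓝 0, ‖z' z‖ < ‖p‖ :=
      hz'c.norm.continuousAt.eventually_lt_const (by simpa [hz0] using hpn)
    filter_upwards [h1, h2] with z hz1 hz2
    refine ⟨lineReflection_comp_mem_rotationSet hz1 hp, fun u hu => ?_⟩
    have hpz : ⟪c z • p, z' z⟫ = 0 := by
      rw [inner_smul_left, real_inner_comm, hz'W z p hpW, mul_zero]
    have hnorm : ‖p‖ = ‖u' z‖ := by
      have hc2 : c z ^ 2 = 1 - ‖z' z‖ ^ 2 / ‖p‖ ^ 2 := by
        refine Real.sq_sqrt (sub_nonneg.2 ?_)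
        rw [div_le_one (by positivity)]
        gcongr
      have : ‖u' z‖ ^ 2 = ‖p‖ ^ 2 := by
        rw [norm_sub_sq_real, hpz, norm_smul, mul_pow, Real.norm_eq_abs, sq_abs, hc2]
        field_simp
        ring
      exact (pow_left_inj₀ (norm_nonneg _) (norm_nonneg _) two_ne_zero).1 this.symm
    have hu1 : ⟪p + u' z, u⟫ = 0 := by
      simp only [u', inner_add_left, inner_sub_left, inner_smul_left, hpU u hu, hz'W z u (hUW hu)]
      simp
    have hs : ((lineReflection (p + u' z)).comp (lineReflection p)) (p + u) = u' z + u := by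
      rw [ContinuousLinearMap.comp_apply, map_add, lineReflection_self,
        lineReflection_of_inner_eq_zero (hpU u hu), map_add, lineReflection_add hnorm, map_neg,
        lineReflection_of_inner_eq_zero hu1, neg_neg]
    have : z + (u' z + u) = W.starProjection z + c z • p + u := by
      simp only [u', z']; abel
    rw [hs, this]
    exact W.add_mem (W.add_mem (W.starProjection_apply_mem z) (W.smul_mem _ hpW)) (hUW hu)

/-- Near `g ∈ D`, choose `q ∈ Q` close to `x` and use `g ∘ s z` with `z = g⁻¹ (x - q)`, which is
close to `g` because `s 0` is the identity. -/
theorem dense_setOf_rotation_into_planes {U W : Submodule ℝ E} {p : E} (hp : p ≠ 0)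
    (hpU : ∀ u ∈ U, ⟪p, u⟫ = 0) (hUW : U ≤ W) (hpW : p ∈ W) {D : Set (rotationSet E)}
    (hD : Dense D) {Q : Set E} (hQ : Dense Q) (x : E) :
    Dense {A : rotationSet E | ∃ g ∈ D, ∃ q ∈ Q, ∀ u ∈ U,
      x + A.1 (p + u) ∈ (fun w => q + g.1 w) '' (W : Set E)} := by
  rw [dense_iff_inter_open]
  intro O hO hne
  obtain ⟨g, hgO, hgD⟩ := hD.inter_open_nonempty O hO hne
  obtain ⟨O', hO', rfl⟩ := isOpen_induced_iff.1 hO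
  obtain ⟨s, hsc, hs0, hs⟩ := exists_continuousAt_rotation_into_translate hp hpU hUW hpW
  obtain ⟨ρ, hρ, -⟩ := exists_linearIsometryEquiv_of_mem_rotationSet g.2
  let f : E → E := fun q => ρ.symm (x - q)
  have hf : Continuous f := by fun_prop
  have hfx : f x = 0 := by simp [f]
  have hft : Tendsto f (𝓝 x) (𝓝 0) := hfx ▸ hf.continuousAt
  have hcont : Tendsto (fun q => g.1.comp (s (f q))) (𝓝 x) (𝓝 g.1) := by
    have h1 : Tendsto (fun q => s (f q)) (𝓝 x) (𝓝 (ContinuousLinearMap.id ℝ E)) :=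
      (hs0 ▸ hsc.tendsto : Tendsto s (𝓝 0) _).comp hft
    have h2 : Continuous fun A : E →L[ℝ] E => g.1.comp A := by fun_prop
    simpa [Function.comp_def] using (h2.tendsto _).comp h1
  obtain ⟨q, hqQ, hq1, hq2⟩ := hQ.inter_nhds_nonempty
    ((hft.eventually hs).and (hcont.eventually (hO'.mem_nhds hgO)))
  refine ⟨⟨_, comp_mem_rotationSet g.2 hq1.1⟩, hq2, g, hgD, q, hqQ, fun u hu => ?_⟩
  refine ⟨_, hq1.2 u hu, ?_⟩
  have : g.1 (f q) = x - q := by rw [← hρ]; simp [f]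
  simp only [map_add g.1, this, ContinuousLinearMap.comp_apply]
  abel

end Rotations

/-! ### Distances to affine planes, and dimensions. -/

section Planes
variable {E : Type*} [NormedAddCommGroup E] [InnerProductSpace ℝ E]

theorem infDist_mk'_eq_norm_sub {U : Submodule ℝ E} {x p : E} (h : ∀ u ∈ U, ⟪x - p, u⟫ = 0) :
    infDist x (AffineSubspace.mk' p U : Set E) = ‖x - p‖ := by
  have hp : p ∈ (AffineSubspace.mk' p U : Set E) := AffineSubspace.self_mem_mk' p U
  refine le_antisymm ((infDist_le_dist_of_mem hp).trans_eq (dist_eq_norm _ _)) ?_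
  refine (le_infDist ⟨p, hp⟩).2 fun y hy => ?_
  have hy' : y - p ∈ U := AffineSubspace.mem_mk'.1 hy
  have h1 : x - y = (x - p) - (y - p) := by abel
  rw [dist_eq_norm]
  refine le_of_sq_le_sq ?_ (norm_nonneg _)
  rw [h1, norm_sub_sq_real (x - p), h _ hy']
  nlinarith [sq_nonneg ‖y - p‖]

theorem exists_plane_infDist_eq [FiniteDimensional ℝ E] {U : Submodule ℝ E} {e : E}
    (he : ‖e‖ = 1) (heU : ∀ u ∈ U, ⟪e, u⟫ = 0) {x q : E} {d : ℝ} (hd : dist x q < d) :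
    ∃ p ∈ U ⊔ ℝ ∙ e, infDist x (AffineSubspace.mk' (q + p) U : Set E) = d := by
  have hd0 : 0 ≤ d := dist_nonneg.trans hd.le
  rw [dist_eq_norm] at hd
  set v := x - q with hv
  have hUe : ⟪U.starProjection v, e⟫ = 0 := by
    rw [real_inner_comm]; exact heU _ (U.starProjection_apply_mem v)
  set b := ⟪v, e⟫ with hb
  let a := v - U.starProjection v - b • e
  have haU : ∀ u ∈ U, ⟪a, u⟫ = 0 := fun u hu => by
    simp only [a, inner_sub_left (_ - _), inner_smul_left, heU u hu,
      Submodule.starProjection_inner_eq_zero v u hu]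
    simp
  have hae : ⟪a, e⟫ = 0 := by
    simp only [a, inner_sub_left, inner_smul_left, hUe, real_inner_self_eq_norm_sq, he, ← hb]
    simp
  have had : ‖a‖ ≤ d := by
    refine le_trans (le_of_sq_le_sq ?_ (norm_nonneg _)) hd.le
    have h1 : v = a + (U.starProjection v + b • e) := by simp only [a]; abel
    have h2 : ⟪a, U.starProjection v + b • e⟫ = 0 := by
      rw [inner_add_right, haU _ (U.starProjection_apply_mem v), inner_smul_right, hae]; simp
    conv_rhs => rw [h1]
    rw [norm_add_sq_real, h2]
    nlinarith [sq_nonneg ‖U.starProjection v + b • e‖]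
  -- `a` is the part of `x - q` orthogonal to `U + ℝe`; sliding by `t` along `e` brings the distance
  -- to `√(‖a‖² + t²) = d`.
  let t := √(d ^ 2 - ‖a‖ ^ 2)
  have ht : t ^ 2 = d ^ 2 - ‖a‖ ^ 2 := Real.sq_sqrt (sub_nonneg.2 (by gcongr))
  refine ⟨U.starProjection v + (b + t) • e, Submodule.add_mem_sup (U.starProjection_apply_mem v)
    (Submodule.smul_mem _ _ (Submodule.mem_span_singleton_self e)), ?_⟩
  have hx : x - (q + (U.starProjection v + (b + t) • e)) = a - t • e := by
    simp only [a, hv, add_smul]; abel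
  rw [infDist_mk'_eq_norm_sub, hx]
  · refine (pow_left_inj₀ (norm_nonneg _) hd0 two_ne_zero).1 ?_
    rw [norm_sub_sq_real, inner_smul_right, hae, norm_smul, he, mul_one, Real.norm_eq_abs, sq_abs,
      ht]
    ring
  · intro u hu
    rw [hx, inner_sub_left, inner_smul_left, haU u hu, heU u hu]
    simp

theorem finrank_sup_span_singleton_of_orthogonal [FiniteDimensional ℝ E] {U : Submodule ℝ E}
    {p : E} (hp : p ≠ 0) (hpU : ∀ u ∈ U, ⟪p, u⟫ = 0) :
    finrank ℝ ↥(U ⊔ ℝ ∙ p) = finrank ℝ U + 1 := by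
  have h := Submodule.finrank_sup_add_finrank_inf_eq U (ℝ ∙ p)
  have hd : U ⊓ ℝ ∙ p = ⊥ := by
    rw [Submodule.eq_bot_iff]
    rintro y ⟨hyU, hyp⟩
    obtain ⟨c, rfl⟩ := Submodule.mem_span_singleton.1 hyp
    have := hpU _ hyU
    rw [inner_smul_right, real_inner_self_eq_norm_sq] at this
    rcases mul_eq_zero.1 this with h0 | h0
    · simp [h0]
    · exact absurd (by simpa using h0) hp
  rw [hd, finrank_bot, add_zero, finrank_span_singleton hp] at h
  exact h

theorem dimH_submodule [FiniteDimensional ℝ E] (W : Submodule ℝ E) :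
    dimH (W : Set E) = finrank ℝ W := by
  have h := (isometry_subtype_coe (s := (W : Set E))).dimH_image univ
  rw [image_univ, Subtype.range_coe] at h
  rw [h]
  exact Real.dimH_univ_eq_finrank W

theorem dimH_image_rotation [FiniteDimensional ℝ E] {A : E →L[ℝ] E} (hA : A ∈ rotationSet E)
    (q : E) (W : Submodule ℝ E) : dimH ((fun w => q + A w) '' (W : Set E)) = finrank ℝ W := by
  have : Isometry fun w => q + A w := Isometry.of_dist_eq fun y z => by
    rw [dist_add_left, dist_eq_norm, ← map_sub, hA.1, dist_eq_norm]
  rw [this.dimH_image, dimH_submodule]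

end Planes

/-! ### Faces of the cube in coordinates. -/

section Coordinates
variable {n : ℕ}

/-- The span of the coordinate vectors with index in `J`. -/
noncomputable def coordSubspace (J : Finset (Fin n)) : Submodule ℝ (EuclideanSpace ℝ (Fin n)) :=
  Submodule.span ℝ (range fun j : J => EuclideanSpace.basisFun (Fin n) ℝ j)

/-- The vector with coordinates `0` in `J` and `±1`, according to `σ`, outside `J`. -/
noncomputable def signVector (J : Finset (Fin n)) (σ : Fin n → Bool) : EuclideanSpace ℝ (Fin n) :=
  WithLp.toLp 2 fun i => if i ∈ J then 0 else if σ i then 1 else -1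

theorem finrank_coordSubspace (J : Finset (Fin n)) : finrank ℝ (coordSubspace J) = J.card := by
  have h : LinearIndependent ℝ fun j : J => EuclideanSpace.basisFun (Fin n) ℝ j :=
    (EuclideanSpace.basisFun (Fin n) ℝ).orthonormal.linearIndependent.comp
      (fun j : J => (j : Fin n)) Subtype.coe_injective
  exact (finrank_span_eq_card h).trans (Fintype.card_coe J)

theorem mem_coordSubspace {J : Finset (Fin n)} {y : EuclideanSpace ℝ (Fin n)} :
    y ∈ coordSubspace J ↔ ∀ i, i ∉ J → y i = 0 := by
  constructor
  · intro hy i hi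
    have hle : coordSubspace J ≤ LinearMap.ker (EuclideanSpace.proj i :
        EuclideanSpace ℝ (Fin n) →L[ℝ] ℝ).toLinearMap := by
      refine Submodule.span_le.2 ?_
      rintro _ ⟨j, rfl⟩
      have : i ≠ j := fun h => hi (h ▸ j.2)
      simp [this]
    simpa using hle hy
  · intro h
    rw [← (EuclideanSpace.basisFun (Fin n) ℝ).sum_repr y]
    refine Submodule.sum_mem _ fun i _ => ?_
    by_cases hi : i ∈ J
    · exact Submodule.smul_mem _ _ (Submodule.subset_span ⟨⟨i, hi⟩, rfl⟩)
    · simp [h i hi]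

theorem signVector_ne_zero {J : Finset (Fin n)} (hJ : J.card < n) (σ : Fin n → Bool) :
    signVector J σ ≠ 0 := by
  obtain ⟨i, hi⟩ : ∃ i, i ∉ J := by
    by_contra! h
    rw [Finset.eq_univ_of_forall h] at hJ
    simp at hJ
  intro h
  have := congrArg (fun y : EuclideanSpace ℝ (Fin n) => y i) h
  simp only [signVector, hi, if_false, PiLp.zero_apply] at this
  split_ifs at this <;> norm_num at this

theorem inner_signVector_eq_zero {J : Finset (Fin n)} (σ : Fin n → Bool)
    {u : EuclideanSpace ℝ (Fin n)} (hu : u ∈ coordSubspace J) : ⟪signVector J σ, u⟫ = 0 := by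
  rw [PiLp.inner_apply]
  refine Finset.sum_eq_zero fun i _ => ?_
  by_cases hi : i ∈ J
  · simp [signVector, hi]
  · simp [mem_coordSubspace.1 hu i hi]

theorem sub_signVector_mem_of_mem_cubeFace {r : ℝ} {J : Finset (Fin n)} {σ : Fin n → Bool}
    {y : EuclideanSpace ℝ (Fin n)} (hy : y ∈ cubeFace n r J σ) :
    y - (r / 2) • signVector J σ ∈ coordSubspace J := by
  refine mem_coordSubspace.2 fun i hi => ?_
  rw [PiLp.sub_apply, PiLp.smul_apply, hy.2 i hi]
  simp only [signVector, hi, if_false]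
  split_ifs <;> simp

theorem isCompact_cubeFace (r : ℝ) (J : Finset (Fin n)) (σ : Fin n → Bool) :
    IsCompact (cubeFace n r J σ) := by
  have hcl : IsClosed (cubeFace n r J σ) := by
    have hc : ∀ i, Continuous fun y : EuclideanSpace ℝ (Fin n) => y i := fun i => by fun_prop
    have : cubeFace n r J σ = (⋂ i ∈ J, {y | -(r / 2) ≤ y i ∧ y i ≤ r / 2}) ∩
        ⋂ i, ⋂ (_ : i ∉ J), {y | y i = if σ i then r / 2 else -(r / 2)} := by
      ext y; simp [cubeFace]
    rw [this]
    refine IsClosed.inter (isClosed_biInter fun i _ => ?_)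
      (isClosed_iInter fun i => isClosed_iInter fun _ => isClosed_eq (hc i) continuous_const)
    exact (isClosed_le continuous_const (hc i)).inter (isClosed_le (hc i) continuous_const)
  have hK : IsCompact (WithLp.toLp 2 '' (Set.pi univ fun _ : Fin n => Icc (-|r / 2|) |r / 2|)) :=
    (isCompact_univ_pi fun _ => isCompact_Icc).image (PiLp.continuous_toLp 2 _)
  refine hK.of_isClosed_subset hcl fun y hy => ⟨WithLp.ofLp y, fun i _ => ?_, rfl⟩
  rw [mem_Icc, ← abs_le]
  by_cases hi : i ∈ J
  · exact (abs_le.2 (hy.1 i hi)).trans (le_abs_self _)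
  · rw [hy.2 i hi]
    split_ifs <;> simp

end Coordinates

/-! ### Construction of the set and the Baire argument. -/

theorem theoremt (n k : ℕ) (hk : k < n) :
    ∃ B₁ B₂ : Set (EuclideanSpace ℝ (Fin n)),
      MeasurableSet B₁ ∧ MeasurableSet B₂ ∧
      dimH B₁ = (k : ENNReal) + 1 ∧ dimH B₂ = (k : ENNReal) + 1 ∧
      ∀ x : EuclideanSpace ℝ (Fin n),
        (∀ d : ℝ, 0 < d →
          ∃ P : AffineSubspace ℝ (EuclideanSpace ℝ (Fin n)), IsKPlane k P ∧
            Metric.infDist x (P : Set (EuclideanSpace ℝ (Fin n))) = d ∧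
            (P : Set (EuclideanSpace ℝ (Fin n))) ⊆ B₁) ∧
        (∀ r : ℝ, 0 < r →
          ∃ ρ : EuclideanSpace ℝ (Fin n) ≃ₗᵢ[ℝ] EuclideanSpace ℝ (Fin n), IsRotation ρ ∧
            (fun y => x + ρ y) '' cubeSkeleton n k r ⊆ B₂) := by
  let E := EuclideanSpace ℝ (Fin n)
  let I := {J : Finset (Fin n) // J.card = k}
  obtain ⟨D, hDc, hD⟩ := TopologicalSpace.exists_countable_dense (rotationSet E)
  obtain ⟨Q, hQc, hQ⟩ := TopologicalSpace.exists_countable_dense E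
  have := hDc.to_subtype
  have := hQc.to_subtype
  let W : I × (Fin n → Bool) → Submodule ℝ E := fun a =>
    coordSubspace a.1.1 ⊔ ℝ ∙ signVector a.1.1 a.2
  have hp : ∀ a : I × (Fin n → Bool), signVector a.1.1 a.2 ≠ 0 := fun a =>
    signVector_ne_zero (by rw [a.1.2]; exact hk) _
  have hW : ∀ a, finrank ℝ (W a) = k + 1 := fun a => by
    rw [finrank_sup_span_singleton_of_orthogonal (hp a)
      fun u hu => inner_signVector_eq_zero _ hu, finrank_coordSubspace, a.1.2]
  let piece : (I × (Fin n → Bool)) × D × Q → Set E := fun a =>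
    (fun w => a.2.2.1 + a.2.1.1.1 w) '' (W a.1 : Set E)
  obtain ⟨J₀, -, hJ₀⟩ := Finset.exists_subset_card_eq
    (s := (Finset.univ : Finset (Fin n))) (n := k) (by simpa using hk.le)
  let a₀ : I × (Fin n → Bool) := ⟨⟨J₀, hJ₀⟩, fun _ => true⟩
  obtain ⟨g₀, hg₀⟩ := hD.nonempty
  obtain ⟨q₀, hq₀⟩ := hQ.nonempty
  have : Nonempty ((I × (Fin n → Bool)) × D × Q) := ⟨⟨a₀, ⟨g₀, hg₀⟩, ⟨q₀, hq₀⟩⟩⟩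
  have hdim : dimH (⋃ a, piece a) = (k : ENNReal) + 1 := by
    rw [dimH_iUnion]
    simp only [piece, dimH_image_rotation (Subtype.property _), hW, ciSup_const]
    push_cast; rfl
  obtain ⟨B, hBδ, hCB, hB⟩ := exists_isGδ_superset_dimH_eq (⋃ a, piece a)
  rw [hdim] at hB
  refine ⟨B, B, hBδ.measurableSet, hBδ.measurableSet, hB, hB, fun x => ⟨fun d hd => ?_,
    fun r hr => ?_⟩⟩
  -- A single rotation `g₀` and a single coordinate subspace suffice here; only `q` depends on `x`
  -- and `d`.
  · obtain ⟨q, hqQ, hqd⟩ := hQ.inter_nhds_nonempty (ball_mem_nhds x hd)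
    obtain ⟨ρ, hρ, -⟩ := exists_linearIsometryEquiv_of_mem_rotationSet g₀.2
    let U := coordSubspace J₀
    let e := (‖signVector J₀ fun _ => true‖⁻¹) • signVector J₀ fun _ => true
    have he : ‖ρ e‖ = 1 := by
      rw [ρ.norm_map]; exact norm_smul_inv_norm (𝕜 := ℝ) (hp a₀)
    have heU : ∀ u ∈ U.map ρ.toLinearEquiv.toLinearMap, ⟪ρ e, u⟫ = 0 := by
      rintro _ ⟨u, hu, rfl⟩
      refine (ρ.inner_map_map e u).trans ?_
      rw [inner_smul_left, inner_signVector_eq_zero _ hu, mul_zero]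
    obtain ⟨p, hpU, hpd⟩ := exists_plane_infDist_eq he heU (x := x) (q := q) (d := d)
      (by rwa [dist_comm])
    refine ⟨_, ⟨⟨_, AffineSubspace.self_mem_mk' _ _⟩, ?_⟩, hpd, ?_⟩
    · rw [AffineSubspace.direction_mk', LinearEquiv.finrank_map_eq, finrank_coordSubspace, hJ₀]
    · intro y hy
      refine hCB (mem_iUnion.2 ⟨⟨a₀, ⟨g₀, hg₀⟩, ⟨q, hqQ⟩⟩, ?_⟩)
      have hle : U.map ρ.toLinearEquiv.toLinearMap ⊔ ℝ ∙ ρ e ≤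
          (W a₀).map ρ.toLinearEquiv.toLinearMap := by
        refine sup_le (Submodule.map_mono le_sup_left) ?_
        rw [Submodule.span_singleton_le_iff_mem]
        exact ⟨e, Submodule.mem_sup_right (Submodule.smul_mem _ _
          (Submodule.mem_span_singleton_self _)), rfl⟩
      have hy' : y - (q + p) ∈ U.map ρ.toLinearEquiv.toLinearMap := AffineSubspace.mem_mk'.1 hy
      obtain ⟨w, hw, hwy⟩ := hle (Submodule.add_mem _ (Submodule.mem_sup_left hy') hpU)
      refine ⟨w, hw, ?_⟩
      have hwy' : g₀.1 w = y - (q + p) + p := (hρ w).symm.trans hwy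
      simp only [hwy']
      abel
  · have hdense : Dense (⋂ a : I × (Fin n → Bool),
        {A : rotationSet E | ∀ y ∈ cubeFace n r a.1.1 a.2, x + A.1 y ∈ B}) := by
      refine dense_iInter_of_Gδ
        (fun a => isGδ_setOf_rotation_mapsTo hBδ (isCompact_cubeFace _ _ _) x) fun a => ?_
      refine (dense_setOf_rotation_into_planes (U := coordSubspace a.1.1) (W := W a)
        (p := (r / 2) • signVector a.1.1 a.2) (smul_ne_zero (by positivity) (hp a))
        (fun u hu => by rw [inner_smul_left, inner_signVector_eq_zero _ hu, mul_zero]) le_sup_left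
        (Submodule.mem_sup_right (Submodule.smul_mem _ _ (Submodule.mem_span_singleton_self _)))
        hD hQ x).mono ?_
      rintro A ⟨g, hg, q, hq, h⟩ y hy
      have := h _ (sub_signVector_mem_of_mem_cubeFace hy)
      rw [add_sub_cancel] at this
      exact hCB (mem_iUnion.2 ⟨⟨a, ⟨g, hg⟩, ⟨q, hq⟩⟩, this⟩)
    obtain ⟨A, hA⟩ := hdense.nonempty
    obtain ⟨ρ, hρ, hdet⟩ := exists_linearIsometryEquiv_of_mem_rotationSet A.2
    refine ⟨ρ, hdet, ?_⟩
    rintro _ ⟨y, ⟨J, σ, hJ, hy⟩, rfl⟩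
    simp only [hρ]
    exact mem_iInter.1 hA ⟨⟨J, hJ⟩, σ⟩ y hy
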